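/- Call a smooth map $C:\mathbb R\to\mathbb R^2$ with $|C'(s)|=1$ for all $s\in\mathbb R$ a complete planar curve (parametrized by arclength), and let $\kappa_C(s)=|C''(s)|$ be its curvature as a function of arclength. The curve $C$ is said to be embedded as a closed subset of the plane if $C$ is a homeomorphism onto its image and this image is closed in $\mathbb R^2$. A complete planar curve $C$ is more curved than a complete planar curve $P$ if $\kappa_C(s)\ge\kappa_P(s)$ for all $s\in\mathbb R$ and $\kappa_C(s_0)>\kappa_P(s_0)$ for some $s_0\in\mathbb R$. Theorem. A parabola is the most curved planar curve that is complete and embedded as a closed subset of the plane. That is, let $S\subset\mathbb R^2$ be a parabola (a set congruent to the graph $y=kx^2$ for some $k>0$). Then $S$ is the image of a complete planar curve. Moreover, for every complete planar curve $P$ with image $S$ (that is, for every arclength parametrization of the parabola), $P$ is embedded as a closed subset of the plane, and no complete planar curve $C$ that is more curved than $P$ is embedded as a closed subset of the plane. -/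

import Mathlib

open Set Topology
open scoped ContDiff

/-- The Euclidean plane. -/
abbrev Plane : Type := EuclideanSpace ℝ (Fin 2)

/-- A smooth complete planar curve, parametrized by arclength `s ∈ ℝ`. Completeness of the curve
is the fact that the arclength parameter runs through the whole of `ℝ`. The curve is immersed; it
may cross itself. -/
structure IsCompleteCurve (γ : ℝ → Plane) : Prop where
  contDiff : ContDiff ℝ ∞ γ
  unit_speed : ∀ s : ℝ, ‖deriv γ s‖ = 1

/-- The (unsigned) curvature, as a function of arclength, of a curve that is parametrized
by arclength: the length of the acceleration vector. -/
noncomputable def curvature (γ : ℝ → Plane) (s : ℝ) : ℝ :=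
  ‖deriv (deriv γ) s‖

/-- `C` is more curved than `P`: at equal arclength parameter the curvature of `C` is at least
that of `P`, and it is strictly larger for some value of the parameter. -/
def MoreCurved (C P : ℝ → Plane) : Prop :=
  (∀ s : ℝ, curvature P s ≤ curvature C s) ∧ ∃ s : ℝ, curvature P s < curvature C s

/-- A parabola: a set congruent to the graph `y = k x ^ 2` for some `k > 0`. -/
def IsParabola (S : Set Plane) : Prop :=
  ∃ k : ℝ, 0 < k ∧ ∃ e : Plane ≃ᵢ Plane, S = e '' {p : Plane | p 1 = k * p 0 ^ 2}

/-!
A parabola has total curvature `π`: the direction of its tangent is `arctan (2 k x)`, which runs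
through an interval of length `π`. Its curvature never vanishes, so a more curved curve has no
inflection points and total curvature larger than `π`. The theorem is therefore a consequence of
the following fact (`IsCompleteCurve.integral_curvature_le_pi`): a complete curve without inflection
points that is embedded as a closed subset of the plane has total curvature at most `π`.

To prove this, let `θ` be the tangent angle of such a curve, increasing after a reflection. As the
curve has no double points, its difference quotient `(γ t - γ s) / (t - s)`, extended by the velocity
on the diagonal, has no zeros, and on the simply connected parameter plane it has a continuous
argument `φ s t` (`exists_secant_angle`). The angles `φ s t - θ s` and `θ t - φ s t` of the chord
with the tangents at its end points vanish on the diagonal. The second one crosses multiples of `π`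
only upwards as `t` increases (`IsSecantLift.lt_angle_right`), because at a crossing the chord does
not turn while the tangent does; so it is positive for `s < t`. The first one behaves in the same
way as `s` decreases, since traversing the mirror image backwards exchanges the two angles
(`IsSecantLift.reverse`).

If one of them reaches `π`, take a chord from `a` to `b` on which this happens, say to the first
one, while the other is still at most `π`. Then `γ b` lies on the tangent at `a`, behind `γ a`, and
the branch of the curve before `a` is trapped on the left of all tangents at points of `[a, b]`
(`IsSecantLift.angle_right_lt_pi_of_return`). These tangents turn by more than `π`, so that the
branch is bounded, against properness (`IsSecantLift.not_return`). Hence both angles stay below `π`: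
the curve lies on the left of all its tangents. If it turned by more than `π`, some tangent would
have the curve go away to its right, at a definite rate, as `s → -∞`
(`IsSecantLift.turning_le_pi`).
-/

/-! ### Secant angles of a locally convex curve -/

/-- A function of one real variable that is continuous and is an argument of a differentiable
complex function is differentiable, with the logarithmic derivative's imaginary part as its
derivative. -/
theorem hasDerivAt_of_continuousAt_arg {f : ℝ → ℝ} {g : ℝ → ℂ} {g' : ℂ} {t : ℝ}
    (hf : ContinuousAt f t) (hg : HasDerivAt g g' t) (h0 : g t ≠ 0)
    (h : ∀ᶠ x in 𝓝 t, g x = ‖g x‖ * Complex.exp (f x * Complex.I)) :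
    HasDerivAt f (g' / g t).im t := by
  have hgt := h.self_of_nhds
  have hn : (‖g t‖ : ℂ) ≠ 0 := by simpa using h0
  have h1 : HasDerivAt (fun x => Complex.log (g x / g t)) (g' / g t) t := by
    have h2 : HasDerivAt (fun x => g x / g t) (g' / g t) t := hg.div_const _
    have := h2.clog_real (by simp [div_self h0])
    simpa [div_self h0] using this
  have h2 : HasDerivAt (fun x => f t + (Complex.log (g x / g t)).im) (g' / g t).im t := by
    have := (Complex.imCLM.hasFDerivAt.comp_hasDerivAt t h1).const_add (f t)
    simpa using this
  refine h2.congr_of_eventuallyEq ?_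
  have hc : ∀ᶠ x in 𝓝 t, |f x - f t| < Real.pi := by
    have : ContinuousAt (fun x => |f x - f t|) t := (hf.sub continuousAt_const).abs
    exact this.eventually_lt continuousAt_const (by simpa using Real.pi_pos)
  have hne : ∀ᶠ x in 𝓝 t, g x ≠ 0 := hg.continuousAt.eventually_ne h0
  filter_upwards [h, hc, hne] with x hx hcx hnx
  have hq : g x / g t = ((‖g x‖ / ‖g t‖ : ℝ) : ℂ) *
      Complex.exp (((f x - f t : ℝ) : ℂ) * Complex.I) := by
    conv_lhs => rw [hx, hgt]
    push_cast
    rw [sub_mul, Complex.exp_sub]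
    field_simp
  have hpos : 0 < ‖g x‖ / ‖g t‖ := div_pos (norm_pos_iff.2 hnx) (norm_pos_iff.2 h0)
  rw [abs_lt] at hcx
  rw [Complex.log_im, hq, Complex.exp_mul_I,
    Complex.arg_mul_cos_add_sin_mul_I hpos ⟨hcx.1, hcx.2.le⟩]
  ring

/-- A continuous function that crosses the level `c` only upwards stays above it. -/
theorem lt_of_forall_crossing_up {f : ℝ → ℝ} {c t₀ : ℝ} (hf : ContinuousOn f (Ici t₀))
    (h0 : c ≤ f t₀) (hd : ∀ t, t₀ ≤ t → f t = c → ∃ d > 0, HasDerivAt f d t)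
    {t₁ : ℝ} (ht : t₀ < t₁) : c < f t₁ := by
  have slope_pos : ∀ t, t₀ ≤ t → f t = c → ∀ᶠ x in 𝓝[≠] t, 0 < slope f t x := by
    intro t h1 h2
    obtain ⟨d, hd0, hd1⟩ := hd t h1 h2
    exact (hasDerivAt_iff_tendsto_slope.1 hd1).eventually (lt_mem_nhds hd0)
  by_contra! hle
  obtain ⟨t₂, ht₂, hft₂⟩ : ∃ t₂, t₀ < t₂ ∧ f t₂ < c := by
    rcases hle.lt_or_eq with h | h
    · exact ⟨t₁, ht, h⟩
    · have h1 : ∀ᶠ x in 𝓝[<] t₁, 0 < slope f t₁ x :=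
        (slope_pos t₁ ht.le h).filter_mono (nhdsWithin_mono _ fun x hx => ne_of_lt hx)
      obtain ⟨x, hx, hx1, hx2⟩ := (h1.and (Ioo_mem_nhdsLT ht)).exists
      refine ⟨x, hx1, ?_⟩
      rw [slope_def_field] at hx
      by_contra! hcx
      exact absurd hx (not_lt.2 (div_nonpos_of_nonneg_of_nonpos (by linarith) (by linarith)))
  obtain ⟨u, ⟨⟨hu0, hu2⟩, hfu⟩, humax⟩ : ∃ u, IsGreatest (Icc t₀ t₂ ∩ f ⁻¹' Ici c) u := by
    have hcl : IsClosed (Icc t₀ t₂ ∩ f ⁻¹' Ici c) :=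
      (hf.mono Icc_subset_Ici_self).preimage_isClosed_of_isClosed isClosed_Icc isClosed_Ici
    exact (isCompact_Icc.of_isClosed_subset hcl inter_subset_left).exists_isGreatest
      ⟨t₀, ⟨le_rfl, ht₂.le⟩, h0⟩
  have hut : u < t₂ := lt_of_le_of_ne hu2 (by rintro rfl; exact absurd hft₂ (not_lt.2 hfu))
  have hbelow : ∀ x ∈ Ioo u t₂, f x < c := by
    intro x hx
    by_contra! hcx
    exact absurd (humax ⟨⟨hu0.trans hx.1.le, hx.2.le⟩, hcx⟩) (not_le.2 hx.1)
  have hfu' : f u = c := by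
    refine le_antisymm ?_ hfu
    have hcont : ContinuousWithinAt f (Ioi u) u :=
      (hf u hu0).mono fun x hx => hu0.trans (le_of_lt hx)
    refine le_of_tendsto hcont ?_
    filter_upwards [Ioo_mem_nhdsGT hut] with x hx using (hbelow x hx).le
  have h1 : ∀ᶠ x in 𝓝[>] u, 0 < slope f u x :=
    (slope_pos u hu0 hfu').filter_mono (nhdsWithin_mono _ fun x hx => ne_of_gt hx)
  obtain ⟨x, hx, hx1⟩ := (h1.and (Ioo_mem_nhdsGT hut)).exists
  have := hbelow x hx1
  rw [slope_def_field] at hx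
  exact absurd hx (not_lt.2 (div_nonpos_of_nonpos_of_nonneg (by linarith) (by linarith [hx1.1])))

/-- A locally convex plane curve `γ` of unit speed without double points, with tangent angle `θ`
and secant angle `φ`: for `s < t` the number `φ s t` is an argument of `γ t - γ s`, and the secant
angle extends the tangent angle continuously across the diagonal. The values of `φ s t` for
`t < s` only matter through continuity. -/
structure IsSecantLift (γ : ℝ → ℂ) (θ : ℝ → ℝ) (φ : ℝ → ℝ → ℝ) : Prop where
  tangent : ∀ s, HasDerivAt γ (Complex.exp (θ s * Complex.I)) s
  turning : ∀ s, ∃ κ > 0, HasDerivAt θ κ s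
  cont : Continuous fun p : ℝ × ℝ => φ p.1 p.2
  diag : ∀ s, φ s s = θ s
  ne : ∀ s t, s < t → γ t ≠ γ s
  secant : ∀ s t, s < t → γ t - γ s = ‖γ t - γ s‖ * Complex.exp (φ s t * Complex.I)

/-- The signed distance of the point `p` from the line through `q` of direction angle `α`, positive
to the left of that line. -/
noncomputable def heightAbove (q : ℂ) (α : ℝ) (p : ℂ) : ℝ :=
  ((p - q) * Complex.exp (-α * Complex.I)).im

theorem heightAbove_eq (q : ℂ) (α : ℝ) (p : ℂ) :
    heightAbove q α p = (p - q).im * Real.cos α - (p - q).re * Real.sin α := by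
  have : Complex.exp (-α * Complex.I) = ⟨Real.cos α, -Real.sin α⟩ := by
    apply Complex.ext <;> simp [Complex.exp_re, Complex.exp_im]
  rw [heightAbove, this, Complex.mul_im]
  ring

theorem heightAbove_of_polar {q p : ℂ} {r α β : ℝ} (h : p - q = r * Complex.exp (β * Complex.I)) :
    heightAbove q α p = r * Real.sin (β - α) := by
  have h1 : (p - q).re = r * Real.cos β := by
    rw [h, Complex.re_ofReal_mul, Complex.exp_ofReal_mul_I_re]
  have h2 : (p - q).im = r * Real.sin β := by
    rw [h, Complex.im_ofReal_mul, Complex.exp_ofReal_mul_I_im]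
  rw [heightAbove_eq, h1, h2, Real.sin_sub]
  ring

namespace IsSecantLift

variable {γ : ℝ → ℂ} {θ : ℝ → ℝ} {φ : ℝ → ℝ → ℝ}

theorem norm_pos (h : IsSecantLift γ θ φ) {s t : ℝ} (hst : s < t) : 0 < ‖γ t - γ s‖ :=
  norm_pos_iff.2 (sub_ne_zero.2 (h.ne s t hst))

theorem continuous_angle (h : IsSecantLift γ θ φ) : Continuous θ :=
  continuous_iff_continuousAt.2 fun s => (h.turning s).choose_spec.2.continuousAt

theorem strictMono_angle (h : IsSecantLift γ θ φ) : StrictMono θ :=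
  strictMono_of_deriv_pos fun s => by
    obtain ⟨κ, h0, h1⟩ := h.turning s
    rwa [h1.deriv]

theorem continuous_secant (h : IsSecantLift γ θ φ) {f g : ℝ → ℝ} (hf : Continuous f)
    (hg : Continuous g) : Continuous fun x => φ (f x) (g x) :=
  h.cont.comp (hf.prodMk hg)

/-- The mirror image of the curve, traversed backwards. It exchanges the two angles between a chord
and the tangents at its end points. -/
theorem reverse (h : IsSecantLift γ θ φ) :
    IsSecantLift (fun s => -(starRingEnd ℂ) (γ (-s))) (fun s => -θ (-s))
      (fun s t => -φ (-t) (-s)) where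
  tangent s := by
    have h1 := ((h.tangent (-s)).scomp s (hasDerivAt_neg s)).star.neg
    refine h1.congr_deriv ?_
    simp [← Complex.exp_conj]
  turning s := by
    obtain ⟨κ, h0, h1⟩ := h.turning (-s)
    refine ⟨κ, h0, ?_⟩
    exact (h1.comp s (hasDerivAt_neg s)).neg.congr_deriv (by simp)
  cont := (h.cont.comp ((continuous_neg.comp continuous_snd).prodMk
    (continuous_neg.comp continuous_fst))).neg
  diag s := by simp [h.diag]
  ne s t hst heq := by
    have : γ (-t) = γ (-s) := (starRingEnd ℂ).injective (neg_injective heq)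
    exact h.ne (-t) (-s) (by linarith) this.symm
  secant s t hst := by
    have h1 := congrArg (starRingEnd ℂ) (h.secant (-t) (-s) (by linarith))
    have h2 : -(starRingEnd ℂ) (γ (-t)) - -(starRingEnd ℂ) (γ (-s)) =
        (starRingEnd ℂ) (γ (-s) - γ (-t)) := by simp; ring
    rw [h2, h1, map_mul, norm_mul, ← Complex.exp_conj]
    simp [Complex.norm_exp]

theorem height_left (h : IsSecantLift γ θ φ) {r s : ℝ} (hrs : r < s) :
    heightAbove (γ s) (θ s) (γ r) = ‖γ s - γ r‖ * Real.sin (θ s - φ r s) := by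
  have h1 : γ r - γ s = ((-‖γ s - γ r‖ : ℝ) : ℂ) * Complex.exp (φ r s * Complex.I) := by
    rw [← neg_sub, h.secant r s hrs]
    simp [Complex.norm_exp]
  rw [heightAbove_of_polar h1, ← neg_sub (θ s), Real.sin_neg]
  ring

theorem height_right (h : IsSecantLift γ θ φ) {s t : ℝ} (hst : s < t) :
    heightAbove (γ s) (θ s) (γ t) = ‖γ t - γ s‖ * Real.sin (φ s t - θ s) :=
  heightAbove_of_polar (h.secant s t hst)

/-- The height of `γ u` above a fixed line changes with the sine of the angle between the tangent
and that line. -/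
theorem hasDerivAt_height (h : IsSecantLift γ θ φ) (q : ℂ) (α u : ℝ) :
    HasDerivAt (fun u => heightAbove q α (γ u)) (Real.sin (θ u - α)) u := by
  have h3 := ((h.tangent u).sub_const q).mul_const (Complex.exp (-α * Complex.I))
  have h4 := Complex.imCLM.hasFDerivAt.comp_hasDerivAt u h3
  refine h4.congr_deriv ?_
  rw [← Complex.exp_add, Complex.imCLM_apply, ← add_mul]
  have : ((θ u : ℂ) + -α) = ((θ u - α : ℝ) : ℂ) := by push_cast; ring
  rw [this, Complex.exp_ofReal_mul_I_im]

/-- When its left end is kept fixed, the secant turns with velocity `sin ψ / ρ`, where `ψ` is its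
angle with the tangent at the right end and `ρ` is its length. -/
theorem hasDerivAt_secant (h : IsSecantLift γ θ φ) {s t : ℝ} (hst : s < t) :
    HasDerivAt (φ s) (Real.sin (θ t - φ s t) / ‖γ t - γ s‖) t := by
  have hc : ContinuousAt (φ s) t :=
    (h.continuous_secant continuous_const continuous_id).continuousAt
  have h1 := hasDerivAt_of_continuousAt_arg hc ((h.tangent t).sub_const (γ s))
    (sub_ne_zero.2 (h.ne s t hst)) (by
      filter_upwards [lt_mem_nhds hst] with x hx using h.secant s x hx)
  convert h1 using 1
  have hn := h.norm_pos hst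
  have hn' : (‖γ t - γ s‖ : ℂ) ≠ 0 := by exact_mod_cast hn.ne'
  have h2 : Complex.exp (θ t * Complex.I) / (γ t - γ s) =
      ((‖γ t - γ s‖⁻¹ : ℝ) : ℂ) * Complex.exp (((θ t - φ s t : ℝ) : ℂ) * Complex.I) := by
    conv_lhs => rw [h.secant s t hst]
    push_cast
    rw [sub_mul, Complex.exp_sub]
    field_simp
  rw [h2, Complex.im_ofReal_mul, Complex.exp_ofReal_mul_I_im]
  ring

/-- The angle from the secant to the tangent at its right end is positive just to the right of the
diagonal. -/
theorem angle_right_pos_near (h : IsSecantLift γ θ φ) (s : ℝ) :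
    ∀ᶠ t in 𝓝[>] s, 0 < θ t - φ s t := by
  have hc : ContinuousAt (fun t => |θ t - φ s t|) s :=
    (h.continuous_angle.sub (h.continuous_secant continuous_const continuous_id)).abs.continuousAt
  have hc1 : ∀ᶠ t in 𝓝[>] s, |θ t - φ s t| < Real.pi :=
    (hc.eventually_lt continuousAt_const (by simpa [h.diag] using Real.pi_pos)).filter_mono
      nhdsWithin_le_nhds
  have hc2 : ∀ᶠ t in 𝓝[>] s, θ t < θ s + Real.pi :=
    (h.continuous_angle.continuousAt.eventually_lt continuousAt_const
      (by linarith [Real.pi_pos])).filter_mono nhdsWithin_le_nhds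
  filter_upwards [hc1, hc2, self_mem_nhdsWithin] with t h1 h2 hst
  have hst' : s < t := hst
  rw [abs_lt] at h1
  -- the height of `γ u` over the tangent at `t` decreases to `0` on `[s, t]`
  have hd := h.hasDerivAt_height (γ t) (θ t)
  have hanti : StrictAntiOn (fun u => heightAbove (γ t) (θ t) (γ u)) (Icc s t) := by
    refine strictAntiOn_of_deriv_neg (convex_Icc s t)
      (fun u _ => (hd u).continuousAt.continuousWithinAt) fun u hu => ?_
    rw [interior_Icc] at hu
    rw [(hd u).deriv]
    have h5 := h.strictMono_angle hu.1
    have h6 := h.strictMono_angle hu.2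
    exact Real.sin_neg_of_neg_of_neg_pi_lt (by linarith) (by linarith)
  have h7 := hanti (left_mem_Icc.2 hst'.le) (right_mem_Icc.2 hst'.le) hst'
  simp only [h.height_left hst'] at h7
  have h8 : heightAbove (γ t) (θ t) (γ t) = 0 := by simp [heightAbove]
  rw [h8] at h7
  by_contra! hle
  have h9 : Real.sin (θ t - φ s t) ≤ 0 :=
    Real.sin_nonpos_of_nonpos_of_neg_pi_le hle h1.1.le
  exact absurd h7 (not_lt.2 (mul_nonpos_of_nonneg_of_nonpos (norm_nonneg _) h9))

/-- The angle from the secant to the tangent at its right end crosses the multiples of `π` only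
upwards, as the right end advances: at such a crossing the secant does not turn, and the tangent
does. -/
theorem lt_angle_right (h : IsSecantLift γ θ φ) {c s t u : ℝ} (hc : Real.sin c = 0) (hst : s < t)
    (htu : t < u) (h0 : c ≤ θ t - φ s t) : c < θ u - φ s u := by
  refine lt_of_forall_crossing_up (f := fun t => θ t - φ s t) (t₀ := t)
    (h.continuous_angle.sub (h.continuous_secant continuous_const continuous_id)).continuousOn h0
    (fun x hx hxc => ?_) htu
  obtain ⟨κ, hκ, hθ⟩ := h.turning x
  refine ⟨κ, hκ, ?_⟩
  exact (hθ.sub (h.hasDerivAt_secant (hst.trans_le hx))).congr_deriv (by simp [hxc, hc])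

theorem angle_right_pos (h : IsSecantLift γ θ φ) {s t : ℝ} (hst : s < t) : 0 < θ t - φ s t := by
  obtain ⟨u, hu, hu1, hu2⟩ := ((h.angle_right_pos_near s).and (Ioo_mem_nhdsGT hst)).exists
  exact h.lt_angle_right Real.sin_zero hu1 hu2 hu.le

end IsSecantLift

/-! ### Properness bounds the total turning by `π` -/

theorem heightAbove_sub (q : ℂ) (α : ℝ) (p q' : ℂ) :
    heightAbove q α p = heightAbove q' α p - heightAbove q' α q := by
  simp only [heightAbove_eq, Complex.sub_im, Complex.sub_re]
  ring

/-- How the height above a line through the origin changes when the line is rotated by `β`. -/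
theorem heightAbove_zero_add (α β : ℝ) (p : ℂ) :
    heightAbove 0 (α + β) p = heightAbove 0 α p * Real.cos β -
      (p * Complex.exp (-α * Complex.I)).re * Real.sin β := by
  have h : ((p - 0) * Complex.exp (-(α + β : ℝ) * Complex.I)) =
      p * Complex.exp (-α * Complex.I) * ⟨Real.cos β, -Real.sin β⟩ := by
    have : Complex.exp (-β * Complex.I) = ⟨Real.cos β, -Real.sin β⟩ := by
      apply Complex.ext <;> simp [Complex.exp_re, Complex.exp_im]
    rw [← this, mul_assoc, ← Complex.exp_add]
    congr 2
    · ring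
    · push_cast; ring
  rw [heightAbove, h, Complex.mul_im, heightAbove, sub_zero]
  ring

/-- Half-planes whose boundary directions turn through more than `π` have a bounded
intersection. -/
theorem exists_norm_le_of_heightAbove_nonneg (q₀ q₁ q₂ q₃ : ℂ) (α : ℝ) {ε : ℝ} (h0 : 0 < ε)
    (h1 : ε ≤ Real.pi / 2) :
    ∃ M, ∀ p, 0 ≤ heightAbove q₀ α p → 0 ≤ heightAbove q₁ (α + Real.pi / 2) p →
      0 ≤ heightAbove q₂ (α + Real.pi) p → 0 ≤ heightAbove q₃ (α + (Real.pi + ε)) p → ‖p‖ ≤ M := by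
  have hs : 0 < Real.sin ε := Real.sin_pos_of_pos_of_lt_pi h0 (by linarith [Real.pi_pos])
  have hc : 0 ≤ Real.cos ε := Real.cos_nonneg_of_neg_pi_div_two_le_of_le (by linarith) h1
  have hc1 : Real.cos ε ≤ 1 := Real.cos_le_one ε
  refine ⟨(|heightAbove 0 α q₀| + |heightAbove 0 (α + Real.pi) q₂|) +
    (|heightAbove 0 (α + Real.pi / 2) q₁| +
      (|heightAbove 0 (α + (Real.pi + ε)) q₃| + (|heightAbove 0 α q₀| +
        |heightAbove 0 (α + Real.pi) q₂|)) / Real.sin ε), fun p => ?_⟩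
  rw [heightAbove_sub q₀ _ p 0, heightAbove_sub q₁ _ p 0, heightAbove_sub q₂ _ p 0,
    heightAbove_sub q₃ _ p 0, heightAbove_zero_add α (Real.pi / 2) p,
    heightAbove_zero_add α Real.pi p, heightAbove_zero_add α (Real.pi + ε) p,
    Real.cos_pi_div_two, Real.sin_pi_div_two, Real.cos_pi, Real.sin_pi, add_comm Real.pi ε,
    Real.cos_add_pi, Real.sin_add_pi]
  generalize heightAbove 0 α q₀ = m₀
  generalize heightAbove 0 (α + Real.pi / 2) q₁ = m₁
  generalize heightAbove 0 (α + Real.pi) q₂ = m₂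
  generalize heightAbove 0 (α + (ε + Real.pi)) q₃ = m₃
  have hn : ‖p‖ = ‖p * Complex.exp (-α * Complex.I)‖ := by
    rw [norm_mul, ← Complex.ofReal_neg, Complex.norm_exp_ofReal_mul_I, mul_one]
  have hv : heightAbove 0 α p = (p * Complex.exp (-α * Complex.I)).im := by simp [heightAbove]
  rw [hn, hv]
  generalize p * Complex.exp (-α * Complex.I) = z
  intro k0 k1 k2 k3
  have hvabs : |z.im| ≤ |m₀| + |m₂| := by
    rw [abs_le]
    constructor <;>
    linarith [neg_abs_le m₀, neg_abs_le m₂, abs_nonneg m₀, abs_nonneg m₂]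
  have hquot : 0 ≤ (|m₃| + (|m₀| + |m₂|)) / Real.sin ε := by positivity
  have huabs : |z.re| ≤ |m₁| + (|m₃| + (|m₀| + |m₂|)) / Real.sin ε := by
    rw [abs_le]
    constructor
    · have hcv : |z.im * Real.cos ε| ≤ |z.im| := by
        rw [abs_mul, abs_of_nonneg hc]
        exact mul_le_of_le_one_right (abs_nonneg _) hc1
      have : -(|m₃| + (|m₀| + |m₂|)) ≤ z.re * Real.sin ε := by
        linarith [neg_abs_le m₃, neg_abs_le (z.im * Real.cos ε)]
      have h5 : -((|m₃| + (|m₀| + |m₂|)) / Real.sin ε) ≤ z.re := by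
        rw [← neg_div, div_le_iff₀ hs]
        exact this
      linarith [abs_nonneg m₁]
    · linarith [neg_abs_le m₁]
  exact (Complex.norm_le_abs_re_add_abs_im z).trans (by linarith)

namespace IsSecantLift

variable {γ : ℝ → ℂ} {θ : ℝ → ℝ} {φ : ℝ → ℝ → ℝ}

/-- Suppose that the curve returns at `b` to the tangent at `a`, behind `γ a`. Then the branch
before `a` never reaches the tangent ray at `b`: it lies to the left of the tangent at `a`, the ray
does not. -/
theorem angle_right_ne_pi (h : IsSecantLift γ θ φ) {a b r : ℝ} (hab : a < b)
    (h1 : φ a b - θ a = Real.pi) (h2 : θ b - φ a b ≤ Real.pi) (hr : r < a) :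
    θ b - φ r b ≠ Real.pi := by
  intro heq
  have h3 : θ a - φ r a < Real.pi := by
    by_contra! hle
    exact (h.lt_angle_right Real.sin_pi hr hab hle).ne' heq
  have h4 : 0 < heightAbove (γ a) (θ a) (γ r) := by
    rw [h.height_left hr]
    exact mul_pos (h.norm_pos hr) (Real.sin_pos_of_pos_of_lt_pi (h.angle_right_pos hr) h3)
  have h5 : heightAbove (γ a) (θ a) (γ b) = 0 := by
    rw [h.height_right hab, h1, Real.sin_pi, mul_zero]
  have h6 : 0 ≤ heightAbove (γ r) (θ a) (γ b) := by
    rw [heightAbove_of_polar (h.secant r b (hr.trans hab))]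
    refine mul_nonneg (norm_nonneg _) (Real.sin_nonneg_of_nonneg_of_le_pi ?_ ?_)
    · linarith [h.angle_right_pos hab]
    · linarith
  linarith [heightAbove_sub (γ r) (θ a) (γ b) (γ a)]

/-- Under the assumptions of `angle_right_ne_pi`, the points shortly before `γ a` are to the left of
the tangent at `b`. When that tangent coincides with the one at `a`, this holds because they are to
the left of the latter. -/
theorem angle_right_lt_pi_near (h : IsSecantLift γ θ φ) {a b : ℝ} (hab : a < b)
    (h1 : φ a b - θ a = Real.pi) (h2 : θ b - φ a b ≤ Real.pi) :
    ∀ᶠ r in 𝓝[<] a, θ b - φ r b < Real.pi := by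
  have hc : Continuous fun r => θ b - φ r b :=
    continuous_const.sub (h.continuous_secant continuous_id continuous_const)
  rcases h2.lt_or_eq with h2 | h2
  · exact (hc.continuousAt.eventually_lt continuousAt_const h2).filter_mono nhdsWithin_le_nhds
  · have e1 : ∀ᶠ r in 𝓝[<] a, θ b - φ r b < 2 * Real.pi :=
      (hc.continuousAt.eventually_lt continuousAt_const (by linarith [Real.pi_pos])).filter_mono
        nhdsWithin_le_nhds
    have hc' : Continuous fun r => θ a - φ r a :=
      continuous_const.sub (h.continuous_secant continuous_id continuous_const)
    have e2 : ∀ᶠ r in 𝓝[<] a, θ a - φ r a < Real.pi :=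
      (hc'.continuousAt.eventually_lt continuousAt_const (by simp [h.diag, Real.pi_pos])).filter_mono
        nhdsWithin_le_nhds
    filter_upwards [e1, e2, self_mem_nhdsWithin] with r h3 h4 hr
    have hr' : r < a := hr
    -- the tangents at `a` and at `b` are the same oriented line
    have hline : heightAbove (γ b) (θ b) (γ r) = heightAbove (γ a) (θ a) (γ r) := by
      have h5 : heightAbove (γ a) (θ a) (γ b) = 0 := by
        rw [h.height_right hab, h1, Real.sin_pi, mul_zero]
      have h6 : θ b = θ a + 2 * Real.pi := by linarith
      have h7 : heightAbove (γ b) (θ b) (γ r) = heightAbove (γ b) (θ a) (γ r) := by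
        rw [heightAbove_eq, heightAbove_eq, h6, Real.cos_add_two_pi, Real.sin_add_two_pi]
      rw [h7, heightAbove_sub _ _ _ (γ a), h5, sub_zero]
    rw [h.height_left (hr'.trans hab), h.height_left hr'] at hline
    have h8 := mul_pos (h.norm_pos hr')
      (Real.sin_pos_of_pos_of_lt_pi (h.angle_right_pos hr') h4)
    by_contra! hle
    have h9 : Real.sin (θ b - φ r b) ≤ 0 := by
      have := Real.sin_nonneg_of_nonneg_of_le_pi (x := θ b - φ r b - Real.pi) (by linarith)
        (by linarith)
      rw [Real.sin_sub_pi] at this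
      linarith
    linarith [mul_nonpos_of_nonneg_of_nonpos (norm_nonneg (γ b - γ r)) h9]

/-- Under the assumptions of `angle_right_ne_pi`, the whole branch before `a` is to the left of the
tangent at `b`, by continuity of the angle in `r`. -/
theorem angle_right_lt_pi_of_return (h : IsSecantLift γ θ φ) {a b r : ℝ} (hab : a < b)
    (h1 : φ a b - θ a = Real.pi) (h2 : θ b - φ a b ≤ Real.pi) (hr : r < a) :
    θ b - φ r b < Real.pi := by
  by_contra! hle
  obtain ⟨r', h3, h4⟩ := ((h.angle_right_lt_pi_near hab h1 h2).and self_mem_nhdsWithin).exists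
  have hc : ContinuousOn (fun r => θ b - φ r b) (Iio a) :=
    (continuous_const.sub (h.continuous_secant continuous_id continuous_const)).continuousOn
  obtain ⟨x, hx, hxe⟩ := isPreconnected_Iio.intermediate_value (mem_Iio.2 h4) (mem_Iio.2 hr) hc
    ⟨h3.le, hle⟩
  exact h.angle_right_ne_pi hab h1 h2 hx hxe

/-- If the curve returns at `b` to the tangent at `a`, behind `γ a`, then the branch before `a` is
trapped to the left of all tangents between `a` and `b`, hence in a bounded region. -/
theorem not_return (h : IsSecantLift γ θ φ)
    (hp : Filter.Tendsto (fun s => ‖γ s‖) Filter.atBot Filter.atTop) {a b : ℝ} (hab : a < b)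
    (h1 : φ a b - θ a = Real.pi) : ¬ θ b - φ a b ≤ Real.pi := by
  intro h2
  have hδ := h.angle_right_pos hab
  have key : ∀ s ∈ Icc a b, ∀ r < a, 0 ≤ heightAbove (γ s) (θ s) (γ r) := by
    intro s hs r hr
    have hrs : r < s := hr.trans_le hs.1
    have h3 : θ s - φ r s < Real.pi := by
      have h4 := h.angle_right_lt_pi_of_return hab h1 h2 hr
      rcases hs.2.eq_or_lt with rfl | hsb
      · exact h4
      · by_contra! hle
        exact absurd (h.lt_angle_right Real.sin_pi hrs hsb hle) (not_lt.2 h4.le)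
    rw [h.height_left hrs]
    exact mul_nonneg (norm_nonneg _)
      (Real.sin_nonneg_of_nonneg_of_le_pi (h.angle_right_pos hrs).le h3.le)
  have angle : ∀ β, 0 ≤ β → β ≤ θ b - θ a → ∃ s ∈ Icc a b, θ s = θ a + β := fun β hβ hβ' =>
    intermediate_value_Icc hab.le h.continuous_angle.continuousOn
      ⟨by linarith, by linarith⟩
  have hpi := Real.pi_pos
  obtain ⟨s₁, hs₁, e₁⟩ := angle (Real.pi / 2) (by linarith) (by linarith)
  obtain ⟨s₂, hs₂, e₂⟩ := angle Real.pi (by linarith) (by linarith)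
  obtain ⟨s₃, hs₃, e₃⟩ := angle (Real.pi + (θ b - φ a b) / 2) (by linarith) (by linarith)
  obtain ⟨M, hM⟩ := exists_norm_le_of_heightAbove_nonneg (γ a) (γ s₁) (γ s₂) (γ s₃) (θ a)
    (half_pos hδ) (by linarith)
  obtain ⟨r, hr1, hr2⟩ := ((hp.eventually_gt_atTop M).and (Filter.eventually_lt_atBot a)).exists
  refine absurd (hM (γ r) (key a (left_mem_Icc.2 hab.le) r hr2) ?_ ?_ ?_) (not_le.2 hr1)
  · rw [← e₁]; exact key s₁ hs₁ r hr2
  · rw [← e₂]; exact key s₂ hs₂ r hr2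
  · rw [← e₃]; exact key s₃ hs₃ r hr2

/-- A proper locally convex curve without double points lies strictly to the left of each of its
tangents. -/
theorem angles_lt_pi (h : IsSecantLift γ θ φ)
    (hbot : Filter.Tendsto (fun s => ‖γ s‖) Filter.atBot Filter.atTop)
    (htop : Filter.Tendsto (fun s => ‖γ s‖) Filter.atTop Filter.atTop) {s t : ℝ} (hst : s < t) :
    max (φ s t - θ s) (θ t - φ s t) < Real.pi := by
  by_contra! hle
  have hφ : Continuous (φ s) := h.continuous_secant continuous_const continuous_id
  have hc : Continuous fun t => max (φ s t - θ s) (θ t - φ s t) :=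
    (hφ.sub continuous_const).max (h.continuous_angle.sub hφ)
  obtain ⟨u, hu, hmax⟩ := intermediate_value_Icc hst.le hc.continuousOn
    ⟨by simp [h.diag, Real.pi_pos.le], hle⟩
  have hsu : s < u := by
    refine lt_of_le_of_ne hu.1 ?_
    rintro rfl
    simp [h.diag, Real.pi_pos.ne] at hmax
  simp only at hmax
  rcases max_choice (φ s u - θ s) (θ u - φ s u) with hm | hm
  · exact h.not_return hbot hsu (hm.symm.trans hmax) ((le_max_right _ _).trans hmax.le)
  · have hbot' : Filter.Tendsto (fun s => ‖-(starRingEnd ℂ) (γ (-s))‖) Filter.atBot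
        Filter.atTop := by
      simpa [Function.comp_def] using htop.comp Filter.tendsto_neg_atBot_atTop
    refine h.reverse.not_return hbot' (neg_lt_neg hsu) ?_ ?_
    · simp only [neg_neg]; linarith [hm.symm.trans hmax]
    · simp only [neg_neg]; linarith [(le_max_left _ _).trans hmax.le]

/-- A proper locally convex curve without double points turns by at most `π` in all. Otherwise
there would be a tangent from which, as `s → -∞`, the curve goes away to the wrong side at a
definite rate. -/
theorem turning_le_pi (h : IsSecantLift γ θ φ)
    (hbot : Filter.Tendsto (fun s => ‖γ s‖) Filter.atBot Filter.atTop)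
    (htop : Filter.Tendsto (fun s => ‖γ s‖) Filter.atTop Filter.atTop) {a b : ℝ} (hab : a < b) :
    θ b - θ a ≤ Real.pi := by
  by_contra! hgt
  have hpi := Real.pi_pos
  -- lowering the right end point a little keeps the turning away from `2 * π`
  obtain ⟨c, hc, hθc⟩ : ∃ c ∈ Icc a b, θ c = (θ a + Real.pi + θ b) / 2 :=
    intermediate_value_Icc hab.le h.continuous_angle.continuousOn
      ⟨by linarith, by linarith⟩
  have hac : a < c := h.strictMono_angle.lt_iff_lt.1 (by linarith)
  have h2pi : ∀ s ≤ a, θ b - θ s < 2 * Real.pi := by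
    intro s hs
    have h1 := h.angles_lt_pi hbot htop (hs.trans_lt hab)
    linarith [(le_max_left _ _).trans_lt h1, (le_max_right _ _).trans_lt h1]
  set η := (θ b - θ a - Real.pi) / 2 with hη
  have hη0 : 0 < η := by linarith
  have hηpi : η < Real.pi / 2 := by linarith [h2pi a le_rfl]
  have hsin : ∀ s ≤ a, Real.sin η ≤ Real.sin (θ s - θ c) := by
    intro s hs
    have h1 := h.strictMono_angle.monotone hs
    have h2 := h2pi s hs
    -- the shifted angle lies between `η` and `π - η`
    have h3 : Real.sin (θ s - θ c) = Real.sin (θ c - θ s - Real.pi) := by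
      rw [Real.sin_sub_pi, ← Real.sin_neg, neg_sub]
    rw [h3]
    rcases le_total (θ c - θ s - Real.pi) (Real.pi / 2) with h4 | h4
    · exact Real.sin_le_sin_of_le_of_le_pi_div_two (by linarith) h4 (by linarith)
    · rw [← Real.sin_pi_sub (θ c - θ s - Real.pi)]
      exact Real.sin_le_sin_of_le_of_le_pi_div_two (by linarith) (by linarith) (by linarith)
  have hsη : 0 < Real.sin η := Real.sin_pos_of_pos_of_lt_pi hη0 (by linarith)
  set F : ℝ → ℝ := fun s => heightAbove (γ c) (θ c) (γ s) with hF
  have hd : ∀ s, HasDerivAt F (Real.sin (θ s - θ c)) s := fun s =>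
    h.hasDerivAt_height _ _ s
  have hpos : ∀ s ≤ a, 0 < F s := by
    intro s hs
    have hsc := hs.trans_lt hac
    rw [hF]
    simp only
    rw [h.height_left hsc]
    exact mul_pos (h.norm_pos hsc) (Real.sin_pos_of_pos_of_lt_pi (h.angle_right_pos hsc)
      ((le_max_right _ _).trans_lt (h.angles_lt_pi hbot htop hsc)))
  have hgrow : ∀ s < a, Real.sin η * (a - s) ≤ F a - F s := by
    intro s hs
    refine (convex_Icc s a).mul_sub_le_image_sub_of_le_deriv
      (fun x _ => (hd x).continuousAt.continuousWithinAt)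
      (fun x _ => (hd x).differentiableAt.differentiableWithinAt) (fun x hx => ?_)
      s (left_mem_Icc.2 hs.le) a (right_mem_Icc.2 hs.le) hs.le
    rw [(hd x).deriv]
    rw [interior_Icc] at hx
    exact hsin x hx.2.le
  have hFa := hpos a le_rfl
  have h1 : a - F a / Real.sin η < a := by linarith [div_pos hFa hsη]
  have h2 := hgrow _ h1
  have h3 := hpos _ h1.le
  have h4 : Real.sin η * (a - (a - F a / Real.sin η)) = F a := by field_simp; ring
  linarith

end IsSecantLift

/-! ### Existence of secant angles -/

/-- A nowhere vanishing continuous function on a simply connected space has a continuous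
logarithm. -/
theorem exists_continuous_log {X : Type*} [TopologicalSpace X] [SimplyConnectedSpace X]
    [LocallyPathConnectedSpace X] {q : X → ℂ} (hq : Continuous q) (h0 : ∀ x, q x ≠ 0) :
    ∃ L : X → ℂ, Continuous L ∧ ∀ x, Complex.exp (L x) = q x := by
  obtain ⟨x₀⟩ : Nonempty X := inferInstance
  obtain ⟨F, ⟨-, hF⟩, -⟩ := Complex.isCoveringMapOn_exp.existsUnique_continuousMap_lifts
    ⟨q, hq⟩ (Complex.exp_log (h0 x₀)) (fun x => h0 x)
  exact ⟨F, F.continuous, fun x => congrFun hF x⟩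

/-- The difference quotient `(γ t - γ s) / (t - s)` of a curve, extended across the diagonal by the
velocity, as the mean velocity over the interval from `s` to `t`. -/
noncomputable def meanVelocity (γ : ℝ → ℂ) (p : ℝ × ℝ) : ℂ :=
  ∫ u in (0 : ℝ)..1, deriv γ (p.1 + (p.2 - p.1) * u)

theorem continuous_meanVelocity {γ : ℝ → ℂ} (hγ : Continuous (deriv γ)) :
    Continuous (meanVelocity γ) := by
  refine intervalIntegral.continuous_parametric_intervalIntegral_of_continuous' ?_ 0 1
  exact hγ.comp (by fun_prop)

theorem meanVelocity_self (γ : ℝ → ℂ) (s : ℝ) : meanVelocity γ (s, s) = deriv γ s := by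
  simp [meanVelocity]

theorem sub_mul_meanVelocity {γ : ℝ → ℂ} (hd : Differentiable ℝ γ) (hγ : Continuous (deriv γ))
    (s t : ℝ) : ((t - s : ℝ) : ℂ) * meanVelocity γ (s, t) = γ t - γ s := by
  have hγ' : Continuous fun u : ℝ => (t - s) • deriv γ (s + (t - s) * u) := by
    have h1 : Continuous fun u : ℝ => deriv γ (s + (t - s) * u) := hγ.comp (by fun_prop)
    exact h1.const_smul (t - s)
  have h := intervalIntegral.integral_eq_sub_of_hasDerivAt (a := 0) (b := 1)
    (f := fun u => γ (s + (t - s) * u)) (f' := fun u => (t - s) • deriv γ (s + (t - s) * u))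
    (fun u _ => by
      have h1 : HasDerivAt (fun u : ℝ => s + (t - s) * u) (t - s) u := by
        simpa using ((hasDerivAt_id u).const_mul (t - s)).const_add s
      exact (hd _).hasDerivAt.scomp u h1)
    (hγ'.intervalIntegrable _ _)
  rw [intervalIntegral.integral_smul] at h
  rw [meanVelocity, ← Complex.real_smul]
  exact h.trans (by simp)

/-- A curve of unit speed without double points has a secant angle, defined and continuous on the
whole parameter plane, that restricts to a tangent angle on the diagonal. -/
theorem exists_secant_angle {γ : ℝ → ℂ} (hd : Differentiable ℝ γ) (hγ : Continuous (deriv γ))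
    (hunit : ∀ s, ‖deriv γ s‖ = 1) (hinj : Function.Injective γ) :
    ∃ φ : ℝ → ℝ → ℝ, (Continuous fun p : ℝ × ℝ => φ p.1 p.2) ∧
      (∀ s, deriv γ s = Complex.exp (φ s s * Complex.I)) ∧
      ∀ s t, s < t → γ t - γ s = ‖γ t - γ s‖ * Complex.exp (φ s t * Complex.I) := by
  have hne : ∀ p, meanVelocity γ p ≠ 0 := by
    rintro ⟨s, t⟩ h0
    rcases eq_or_ne s t with rfl | hst
    · rw [meanVelocity_self] at h0
      simpa [h0] using hunit s
    · have h1 := sub_mul_meanVelocity hd hγ s t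
      rw [h0, mul_zero] at h1
      exact hst (hinj (sub_eq_zero.1 h1.symm)).symm
  obtain ⟨L, hL, hexp⟩ := exists_continuous_log (continuous_meanVelocity hγ) hne
  have hpolar : ∀ p, meanVelocity γ p =
      ‖meanVelocity γ p‖ * Complex.exp ((L p).im * Complex.I) := by
    intro p
    rw [← hexp, Complex.norm_exp, Complex.ofReal_exp, ← Complex.exp_add, Complex.re_add_im]
  refine ⟨fun s t => (L (s, t)).im, Complex.continuous_im.comp hL, fun s => ?_, fun s t hst => ?_⟩
  · have h1 := hpolar (s, s)
    rw [meanVelocity_self, hunit] at h1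
    simpa using h1
  · have h1 := hpolar (s, t)
    rw [← sub_mul_meanVelocity hd hγ s t, norm_mul, Complex.norm_real, Real.norm_eq_abs,
      abs_of_pos (sub_pos.2 hst), Complex.ofReal_mul, mul_assoc, ← h1]

/-- The tangent angle of a curve of unit speed turns with a velocity whose absolute value is the
curvature. -/
theorem exists_hasDerivAt_tangent_angle {γ : ℝ → ℂ} {θ : ℝ → ℝ} (hθ : Continuous θ)
    (hγ : ContDiff ℝ 1 (deriv γ)) (h : ∀ s, deriv γ s = Complex.exp (θ s * Complex.I)) :
    ∃ θ' : ℝ → ℝ, Continuous θ' ∧ (∀ s, HasDerivAt θ (θ' s) s) ∧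
      ∀ s, |θ' s| = ‖deriv (deriv γ) s‖ := by
  have h0 : ∀ s, deriv γ s ≠ 0 := fun s => by rw [h]; exact Complex.exp_ne_zero _
  have hd : ∀ s, HasDerivAt θ (deriv (deriv γ) s / deriv γ s).im s := fun s =>
    hasDerivAt_of_continuousAt_arg hθ.continuousAt
      (hγ.differentiable one_ne_zero s).hasDerivAt (h0 s)
      (Filter.Eventually.of_forall fun x => by
        rw [h x, Complex.norm_exp_ofReal_mul_I]; simp)
  refine ⟨fun s => (deriv (deriv γ) s / deriv γ s).im, ?_, hd, fun s => ?_⟩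
  · exact Complex.continuous_im.comp ((hγ.continuous_deriv le_rfl).div hγ.continuous h0)
  · have h1 : HasDerivAt (deriv γ) (Complex.exp (θ s * Complex.I) *
        (((deriv (deriv γ) s / deriv γ s).im : ℝ) * Complex.I)) s :=
      ((hd s).ofReal_comp.mul_const Complex.I).cexp.congr_of_eventuallyEq
        (Filter.Eventually.of_forall h)
    have h2 := congrArg norm h1.deriv
    rw [norm_mul, Complex.norm_exp_ofReal_mul_I, norm_mul, Complex.norm_real, Complex.norm_I,
      Real.norm_eq_abs, one_mul, mul_one] at h2
    exact h2.symm

/-- A nowhere vanishing continuous real function has a constant sign. -/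
theorem forall_pos_or_forall_neg_of_continuous {f : ℝ → ℝ} (hf : Continuous f)
    (h0 : ∀ s, f s ≠ 0) : (∀ s, 0 < f s) ∨ ∀ s, f s < 0 := by
  by_contra! hcon
  obtain ⟨⟨s, hs⟩, t, ht⟩ := hcon
  obtain ⟨u, hu⟩ := mem_range_of_exists_le_of_exists_ge hf ⟨s, hs⟩ ⟨t, ht⟩
  exact h0 u hu

/-- A proper curve of unit speed and of nowhere vanishing curvature, without double points, has
total curvature at most `π`. -/
theorem integral_curvature_le_pi {γ : ℝ → ℂ} (hγ : ContDiff ℝ 2 γ)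
    (hunit : ∀ s, ‖deriv γ s‖ = 1) (hinj : Function.Injective γ)
    (hcurv : ∀ s, deriv (deriv γ) s ≠ 0)
    (hbot : Filter.Tendsto (fun s => ‖γ s‖) Filter.atBot Filter.atTop)
    (htop : Filter.Tendsto (fun s => ‖γ s‖) Filter.atTop Filter.atTop) {a b : ℝ} (hab : a < b) :
    ∫ s in a..b, ‖deriv (deriv γ) s‖ ≤ Real.pi := by
  have hd : Differentiable ℝ γ := hγ.differentiable two_ne_zero
  have hγ1 : ContDiff ℝ 1 (deriv γ) := by
    have h1 : ContDiff ℝ (1 + 1) γ := by simpa [one_add_one_eq_two] using hγ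
    exact (contDiff_succ_iff_deriv.1 h1).2.2
  obtain ⟨φ, hφ, htan, hsec⟩ := exists_secant_angle hd hγ1.continuous hunit hinj
  have hθc : Continuous fun s => φ s s := hφ.comp (continuous_id.prodMk continuous_id)
  obtain ⟨θ', hθ'c, hθ', habs⟩ := exists_hasDerivAt_tangent_angle hθc hγ1 htan
  have hint : ∫ s in a..b, θ' s = φ b b - φ a a :=
    intervalIntegral.integral_eq_sub_of_hasDerivAt (fun s _ => hθ' s)
      (hθ'c.intervalIntegrable _ _)
  have htan' : ∀ s, HasDerivAt γ (Complex.exp (φ s s * Complex.I)) s := fun s => by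
    rw [← htan]; exact (hd s).hasDerivAt
  have hne : ∀ s t, s < t → γ t ≠ γ s := fun s t hst heq => hst.ne' (hinj heq)
  simp_rw [← habs]
  rcases forall_pos_or_forall_neg_of_continuous hθ'c
    (fun s h0 => hcurv s (by simpa [h0] using (habs s).symm)) with hs | hs
  · have hlift : IsSecantLift γ (fun s => φ s s) φ :=
      ⟨htan', fun s => ⟨_, hs s, hθ' s⟩, hφ, fun _ => rfl, hne, hsec⟩
    simp_rw [fun s => abs_of_pos (hs s), hint]
    exact hlift.turning_le_pi hbot htop hab
  · -- a curve that turns clockwise is replaced by its mirror image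
    have hlift : IsSecantLift (fun s => (starRingEnd ℂ) (γ s)) (fun s => -φ s s)
        (fun s t => -φ s t) := by
      refine ⟨fun s => ?_, fun s => ⟨_, neg_pos.2 (hs s), (hθ' s).neg⟩, hφ.neg, fun _ => rfl,
        fun s t hst heq => hne s t hst ((starRingEnd ℂ).injective heq), fun s t hst => ?_⟩
      · refine (htan' s).star.congr_deriv ?_
        simp [← Complex.exp_conj]
      · have h1 := congrArg (starRingEnd ℂ) (hsec s t hst)
        rw [← map_sub, h1, map_mul, norm_mul, ← Complex.exp_conj]
        simp [Complex.norm_exp]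
    simp_rw [fun s => abs_of_neg (hs s), intervalIntegral.integral_neg, hint]
    have := hlift.turning_le_pi (by simpa using hbot) (by simpa using htop) hab
    linarith

/-! ### Complete planar curves -/

theorem IsCompleteCurve.differentiable {γ : ℝ → Plane} (h : IsCompleteCurve γ) :
    Differentiable ℝ γ :=
  h.contDiff.differentiable (by simp)

theorem IsCompleteCurve.contDiff_deriv {γ : ℝ → Plane} (h : IsCompleteCurve γ) :
    ContDiff ℝ ∞ (deriv γ) :=
  (contDiff_infty_iff_deriv.1 h.contDiff).2

theorem IsCompleteCurve.continuous_curvature {γ : ℝ → Plane} (h : IsCompleteCurve γ) :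
    Continuous (curvature γ) :=
  (h.contDiff_deriv.continuous_deriv (by simp)).norm

theorem deriv_linearIsometryEquiv_comp_add {E F : Type*} [NormedAddCommGroup E] [NormedSpace ℝ E]
    [NormedAddCommGroup F] [NormedSpace ℝ F] (A : E ≃ₗᵢ[ℝ] F) (c : F) {γ : ℝ → E}
    (hγ : Differentiable ℝ γ) : deriv (fun s => A (γ s) + c) = fun s => A (deriv γ s) := by
  funext s
  exact ((A.toContinuousLinearEquiv.hasFDerivAt.comp_hasDerivAt s (hγ s).hasDerivAt).add_const
    c).deriv

/-- By the Mazur–Ulam theorem, a congruence is a linear isometry followed by a translation. -/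
theorem exists_linearIsometryEquiv_add {E F : Type*} [NormedAddCommGroup E] [NormedSpace ℝ E]
    [NormedAddCommGroup F] [NormedSpace ℝ F] (e : E ≃ᵢ F) :
    ∃ (A : E ≃ₗᵢ[ℝ] F) (c : F), ∀ x, e x = A x + c := by
  refine ⟨e.toRealAffineIsometryEquiv.linearIsometryEquiv, e 0, fun x => ?_⟩
  have := e.toRealAffineIsometryEquiv.map_vadd 0 x
  simpa using this

theorem IsCompleteCurve.isometryEquiv_comp {γ : ℝ → Plane} (h : IsCompleteCurve γ)
    (e : Plane ≃ᵢ Plane) : IsCompleteCurve (fun s => e (γ s)) := by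
  obtain ⟨A, c, hA⟩ := exists_linearIsometryEquiv_add e
  simp_rw [hA]
  refine ⟨(A.toContinuousLinearEquiv.contDiff.comp h.contDiff).add contDiff_const, fun s => ?_⟩
  rw [deriv_linearIsometryEquiv_comp_add A c h.differentiable]
  simpa using h.unit_speed s

theorem IsCompleteCurve.curvature_isometryEquiv_comp {γ : ℝ → Plane} (h : IsCompleteCurve γ)
    (e : Plane ≃ᵢ Plane) : curvature (fun s => e (γ s)) = curvature γ := by
  obtain ⟨A, c, hA⟩ := exists_linearIsometryEquiv_add e
  funext s
  have h1 := deriv_linearIsometryEquiv_comp_add A 0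
    (h.contDiff_deriv.differentiable (by simp))
  simp only [add_zero] at h1
  simp_rw [hA, curvature]
  rw [deriv_linearIsometryEquiv_comp_add A c h.differentiable, h1]
  exact A.norm_map _

/-- A complete curve that is embedded as a closed subset and has no inflection points has total
curvature at most `π`. -/
theorem IsCompleteCurve.integral_curvature_le_pi {γ : ℝ → Plane} (h : IsCompleteCurve γ)
    (hemb : IsClosedEmbedding γ) (hpos : ∀ s, 0 < curvature γ s) {a b : ℝ} (hab : a < b) :
    ∫ s in a..b, curvature γ s ≤ Real.pi := by
  set A : Plane ≃ₗᵢ[ℝ] ℂ := Complex.orthonormalBasisOneI.repr.symm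
  have h1 := deriv_linearIsometryEquiv_comp_add A 0 h.differentiable
  have h2 := deriv_linearIsometryEquiv_comp_add A 0 (h.contDiff_deriv.differentiable (by simp))
  simp only [add_zero] at h1 h2
  have hcurv : ∀ s, ‖deriv (deriv fun s => A (γ s)) s‖ = curvature γ s := fun s => by
    rw [h1, h2]; exact A.norm_map _
  have hproper : Filter.Tendsto (fun s => ‖A (γ s)‖) (Filter.cocompact ℝ) Filter.atTop := by
    simp_rw [A.norm_map]
    exact (tendsto_norm_cocompact_atTop).comp hemb.tendsto_cocompact
  have hsmooth : ContDiff ℝ ∞ fun s => A (γ s) := A.toContinuousLinearEquiv.contDiff.comp h.contDiff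
  simp_rw [← hcurv]
  refine _root_.integral_curvature_le_pi (γ := fun s => A (γ s)) (contDiff_infty.1 hsmooth 2)
    (fun s => ?_) (A.injective.comp hemb.injective) (fun s h0 => ?_)
    (hproper.mono_left atBot_le_cocompact) (hproper.mono_left atTop_le_cocompact) hab
  · rw [h1]; exact (A.norm_map _).trans (h.unit_speed s)
  · have := hcurv s
    rw [h0, norm_zero] at this
    exact (hpos s).ne this

theorem hasDerivAt_plane_apply {γ : ℝ → Plane} {v : Plane} {s : ℝ} (h : HasDerivAt γ v s)
    (i : Fin 2) : HasDerivAt (fun s => γ s i) (v i) s :=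
  (EuclideanSpace.proj i : Plane →L[ℝ] ℝ).hasFDerivAt.comp_hasDerivAt s h

/-! ### Arclength parametrizations of the parabola -/

theorem isClosedEmbedding_graph_sq (k : ℝ) :
    IsClosedEmbedding fun x : ℝ => (!₂[x, k * x ^ 2] : Plane) := by
  refine Function.LeftInverse.isClosedEmbedding (f := fun p : Plane => p 0) (fun x => by simp)
    (by fun_prop) ?_
  exact (PiLp.continuous_toLp 2 _).comp (continuous_pi fun i => by fin_cases i <;> simp <;> fun_prop)

/-- The abscissa `x` of an arclength parametrization of `y = k x ^ 2`, traversed in the direction of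
increasing `x`. -/
structure IsParabolaAbscissa (k : ℝ) (x : ℝ → ℝ) : Prop where
  contDiff : ContDiff ℝ ∞ x
  deriv_pos : ∀ s, 0 < deriv x s
  speed : ∀ s, deriv x s ^ 2 * (1 + (2 * k * x s) ^ 2) = 1
  surjective : Function.Surjective x

namespace IsParabolaAbscissa

variable {k : ℝ} {x : ℝ → ℝ}

theorem hasDerivAt (h : IsParabolaAbscissa k x) (s : ℝ) : HasDerivAt x (deriv x s) s :=
  (h.contDiff.differentiable (by simp) s).hasDerivAt

theorem strictMono (h : IsParabolaAbscissa k x) : StrictMono x :=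
  strictMono_of_deriv_pos h.deriv_pos

theorem isHomeomorph (h : IsParabolaAbscissa k x) : IsHomeomorph x :=
  (h.strictMono.orderIsoOfSurjective x h.surjective).toHomeomorph.isHomeomorph

/-- The acceleration of the abscissa, from differentiating the condition of unit speed. -/
theorem hasDerivAt_deriv (h : IsParabolaAbscissa k x) (s : ℝ) :
    HasDerivAt (deriv x) (-(4 * k ^ 2 * x s * deriv x s ^ 4)) s := by
  have h2 : HasDerivAt (deriv x) (deriv (deriv x) s) s :=
    ((contDiff_infty_iff_deriv.1 h.contDiff).2.differentiable (by simp) s).hasDerivAt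
  have h3 := (h2.pow 2).mul ((((h.hasDerivAt s).const_mul (2 * k)).pow 2).const_add 1)
  have h5 := h3.unique (by
    refine (hasDerivAt_const s (1 : ℝ)).congr_of_eventuallyEq ?_
    exact Filter.Eventually.of_forall h.speed)
  have hs := h.speed s
  have hp := h.deriv_pos s
  convert h2 using 1
  simp at h5
  generalize deriv (deriv x) s = d at *
  generalize deriv x s = p at *
  have h6 : d * (1 + (2 * k * x s) ^ 2) = -(4 * k ^ 2 * x s * p ^ 2) := by
    apply mul_left_cancel₀ hp.ne'
    linear_combination h5 / 2
  linear_combination d * hs - p ^ 2 * h6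

theorem curvature_eq (h : IsParabolaAbscissa k x) (hk : 0 < k) {γ : ℝ → Plane}
    (hγ : IsCompleteCurve γ) {σ : ℝ} (hσ : σ ^ 2 = 1) (h0 : ∀ s, γ s 0 = σ * x s)
    (h1 : ∀ s, γ s 1 = k * x s ^ 2) (s : ℝ) : curvature γ s = 2 * k * deriv x s ^ 3 := by
  have hv : ∀ s, HasDerivAt γ (deriv γ s) s := fun s => (hγ.differentiable s).hasDerivAt
  have ha : ∀ s, HasDerivAt (deriv γ) (deriv (deriv γ) s) s := fun s =>
    (hγ.contDiff_deriv.differentiable (by simp) s).hasDerivAt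
  have v0 : ∀ s, deriv γ s 0 = σ * deriv x s := fun s => by
    have := hasDerivAt_plane_apply (hv s) 0
    simp_rw [h0] at this
    exact this.unique ((h.hasDerivAt s).const_mul σ)
  have v1 : ∀ s, deriv γ s 1 = k * (2 * x s * deriv x s) := fun s => by
    have := hasDerivAt_plane_apply (hv s) 1
    simp_rw [h1] at this
    exact this.unique ((((h.hasDerivAt s).pow 2).const_mul k).congr_deriv (by simp))
  have a0 : deriv (deriv γ) s 0 = σ * -(4 * k ^ 2 * x s * deriv x s ^ 4) := by
    have := hasDerivAt_plane_apply (ha s) 0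
    simp_rw [v0] at this
    exact this.unique ((h.hasDerivAt_deriv s).const_mul σ)
  have a1 : deriv (deriv γ) s 1 = 2 * k * deriv x s ^ 4 := by
    have := hasDerivAt_plane_apply (ha s) 1
    simp_rw [v1] at this
    rw [this.unique ((((h.hasDerivAt s).const_mul 2).mul (h.hasDerivAt_deriv s)).const_mul k)]
    linear_combination (-2 * k * deriv x s ^ 2) * h.speed s
  have hp := h.deriv_pos s
  rw [curvature, EuclideanSpace.norm_eq, Fin.sum_univ_two, Real.norm_eq_abs, Real.norm_eq_abs,
    sq_abs, sq_abs, a0, a1, Real.sqrt_eq_iff_mul_self_eq (by positivity) (by positivity)]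
  linear_combination (4 * k ^ 2 * deriv x s ^ 6) * h.speed s +
    (4 * k ^ 2 * x s * deriv x s ^ 4) ^ 2 * hσ

/-- The tangent of the parabola of slope `2 k x` has the angle `arctan (2 k x)`, whose velocity is
the curvature. -/
theorem integral_eq (h : IsParabolaAbscissa k x) (a b : ℝ) :
    ∫ s in a..b, 2 * k * deriv x s ^ 3 =
      Real.arctan (2 * k * x b) - Real.arctan (2 * k * x a) := by
  refine intervalIntegral.integral_eq_sub_of_hasDerivAt
    (f := fun s => Real.arctan (2 * k * x s)) (fun s _ => ?_) ?_
  · refine ((h.hasDerivAt s).const_mul (2 * k)).arctan.congr_deriv ?_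
    rw [one_div, ← eq_inv_of_mul_eq_one_left (h.speed s)]
    ring
  · have : Continuous (deriv x) := h.contDiff.continuous_deriv (by simp)
    exact Continuous.intervalIntegrable (by fun_prop) _ _

theorem tendsto_integral (h : IsParabolaAbscissa k x) (hk : 0 < k) :
    Filter.Tendsto (fun R => ∫ s in (-R)..R, 2 * k * deriv x s ^ 3) Filter.atTop
      (𝓝 Real.pi) := by
  simp_rw [h.integral_eq]
  have htop : Filter.Tendsto x Filter.atTop Filter.atTop :=
    (h.strictMono.orderIsoOfSurjective x h.surjective).tendsto_atTop
  have hbot : Filter.Tendsto x Filter.atBot Filter.atBot :=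
    (h.strictMono.orderIsoOfSurjective x h.surjective).tendsto_atBot
  have h1 : Filter.Tendsto (fun R => Real.arctan (2 * k * x R)) Filter.atTop
      (𝓝 (Real.pi / 2)) :=
    (tendsto_nhds_of_tendsto_nhdsWithin Real.tendsto_arctan_atTop).comp
      (htop.const_mul_atTop (by positivity))
  have h2 : Filter.Tendsto (fun R => Real.arctan (2 * k * x (-R))) Filter.atTop
      (𝓝 (-(Real.pi / 2))) :=
    (tendsto_nhds_of_tendsto_nhdsWithin Real.tendsto_arctan_atBot).comp
      ((hbot.comp Filter.tendsto_neg_atTop_atBot).const_mul_atBot (by positivity))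
  have h3 := h1.sub h2
  rwa [sub_neg_eq_add, add_halves] at h3

end IsParabolaAbscissa

/-- The abscissa as a function of arclength is the inverse of the arclength as a function of the
abscissa. -/
theorem exists_isParabolaAbscissa (k : ℝ) : ∃ x, IsParabolaAbscissa k x := by
  set w : ℝ → ℝ := fun u => Real.sqrt (1 + (2 * k * u) ^ 2) with hw
  have hpos : ∀ u, 0 < 1 + (2 * k * u) ^ 2 := fun u => by positivity
  have hwc : ContDiff ℝ ∞ w :=
    ContDiff.sqrt (by fun_prop) fun u => (hpos u).ne'
  have hw1 : ∀ u, 1 ≤ w u := fun u => by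
    rw [hw]; exact Real.one_le_sqrt.2 (by nlinarith [sq_nonneg (2 * k * u)])
  set l : ℝ → ℝ := fun u => ∫ v in (0 : ℝ)..u, w v with hl
  have hld : ∀ u, HasDerivAt l (w u) u := fun u =>
    hwc.continuous.integral_hasStrictDerivAt 0 u |>.hasDerivAt
  have hlc : ContDiff ℝ ∞ l := by
    rw [contDiff_infty_iff_deriv, funext fun u => (hld u).deriv]
    exact ⟨fun u => (hld u).differentiableAt, hwc⟩
  have hmono : StrictMono l := strictMono_of_deriv_pos fun u => by
    rw [(hld u).deriv]; linarith [hw1 u]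
  have hgrow : Monotone fun u => l u - u := by
    have hd : ∀ u, HasDerivAt (fun u => l u - u) (w u - 1) u := fun u =>
      (hld u).sub (hasDerivAt_id u)
    refine monotone_of_deriv_nonneg (fun u => (hd u).differentiableAt) fun u => ?_
    rw [(hd u).deriv]
    linarith [hw1 u]
  have hsurj : Function.Surjective l := by
    refine hlc.continuous.surjective ?_ ?_
    · refine Filter.tendsto_atTop_mono' _ ?_ Filter.tendsto_id
      filter_upwards [Filter.eventually_ge_atTop 0] with u hu
      have := hgrow hu
      simp [hl] at this ⊢
      linarith
    · refine Filter.tendsto_atBot_mono' _ ?_ Filter.tendsto_id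
      filter_upwards [Filter.eventually_le_atBot 0] with u hu
      have := hgrow hu
      simp [hl] at this ⊢
      linarith
  set L : ℝ ≃ₜ ℝ := (hmono.orderIsoOfSurjective l hsurj).toHomeomorph with hL
  have hLc : ContDiff ℝ ∞ L.symm :=
    L.contDiff_symm_deriv (f' := w) (fun u => by linarith [hw1 u]) hld hlc
  have hd : ∀ s, HasDerivAt L.symm (w (L.symm s))⁻¹ s := fun s =>
    (hld (L.symm s)).of_local_left_inverse L.symm.continuous.continuousAt
      (by linarith [hw1 (L.symm s)]) (Filter.Eventually.of_forall fun y => L.apply_symm_apply y)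
  refine ⟨L.symm, hLc, fun s => ?_, fun s => ?_, L.symm.surjective⟩
  · rw [(hd s).deriv]
    exact inv_pos.2 (by linarith [hw1 (L.symm s)])
  · rw [(hd s).deriv, inv_pow, hw, Real.sq_sqrt (hpos _).le]
    exact inv_mul_cancel₀ (hpos _).ne'

/-- An arclength parametrization of `y = k x ^ 2` runs through it monotonically. The sign `σ` is `-1`
when it does so in the direction of decreasing abscissa. -/
theorem exists_isParabolaAbscissa_of_range_eq {k : ℝ} {γ : ℝ → Plane} (hγ : IsCompleteCurve γ)
    (hr : range γ = {p : Plane | p 1 = k * p 0 ^ 2}) :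
    ∃ x, IsParabolaAbscissa k x ∧ ∃ σ : ℝ, σ ^ 2 = 1 ∧ (∀ s, γ s 0 = σ * x s) ∧
      ∀ s, γ s 1 = k * x s ^ 2 := by
  have hx : ContDiff ℝ ∞ fun s => γ s 0 := contDiff_euclidean.1 hγ.contDiff 0
  have hgraph : ∀ s, γ s 1 = k * γ s 0 ^ 2 := fun s => by
    have : γ s ∈ {p : Plane | p 1 = k * p 0 ^ 2} := by rw [← hr]; exact mem_range_self s
    exact this
  have hd : ∀ s, HasDerivAt (fun s => γ s 0) (deriv (fun s => γ s 0) s) s := fun s =>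
    (hx.differentiable (by simp) s).hasDerivAt
  have hspeed : ∀ s, deriv (fun s => γ s 0) s ^ 2 * (1 + (2 * k * γ s 0) ^ 2) = 1 := by
    intro s
    have hv := (hγ.differentiable s).hasDerivAt
    have v0 := (hasDerivAt_plane_apply hv 0).unique (hd s)
    have v1 := hasDerivAt_plane_apply hv 1
    simp_rw [hgraph] at v1
    have v1' := v1.unique (((hd s).pow 2).const_mul k)
    have hn := EuclideanSpace.real_norm_sq_eq (deriv γ s)
    rw [hγ.unit_speed, Fin.sum_univ_two, v0, v1'] at hn
    simp at hn
    linear_combination -hn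
  have hsurj : Function.Surjective fun s => γ s 0 := by
    intro u
    have : (!₂[u, k * u ^ 2] : Plane) ∈ range γ := by rw [hr]; simp
    obtain ⟨s, hs⟩ := this
    exact ⟨s, by simp [hs]⟩
  rcases forall_pos_or_forall_neg_of_continuous (hx.continuous_deriv (by simp))
    (fun s h0 => by simpa [h0] using hspeed s) with hs | hs
  · exact ⟨fun s => γ s 0, ⟨hx, hs, hspeed, hsurj⟩, 1, by simp, by simp, hgraph⟩
  · have hn : deriv (fun s => -γ s 0) = fun s => -deriv (fun s => γ s 0) s :=
      funext fun s => (hd s).neg.deriv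
    refine ⟨fun s => -γ s 0, ⟨hx.neg, fun s => ?_, fun s => ?_, ?_⟩, -1, by simp, by simp,
      by simpa using hgraph⟩
    · rw [hn]; exact neg_pos.2 (hs s)
    · rw [hn]; simpa using hspeed s
    · exact neg_surjective.comp hsurj

theorem IsParabolaAbscissa.isCompleteCurve {k : ℝ} {x : ℝ → ℝ} (h : IsParabolaAbscissa k x) :
    IsCompleteCurve fun s => !₂[x s, k * x s ^ 2] := by
  have hc : ContDiff ℝ ∞ fun s => (!₂[x s, k * x s ^ 2] : Plane) := by
    have := h.contDiff
    refine contDiff_euclidean.2 fun i => ?_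
    fin_cases i
    · simpa using this
    · simpa using contDiff_const.mul (this.pow 2)
  refine ⟨hc, fun s => ?_⟩
  have hv := (hc.differentiable (by simp) s).hasDerivAt
  have v0 := (hasDerivAt_plane_apply hv 0).unique (h.hasDerivAt s)
  have v1 := (hasDerivAt_plane_apply hv 1).unique (((h.hasDerivAt s).pow 2).const_mul k)
  rw [EuclideanSpace.norm_eq, Fin.sum_univ_two, Real.norm_eq_abs, Real.norm_eq_abs,
    sq_abs, sq_abs, v0, v1, Real.sqrt_eq_one]
  simp
  linear_combination h.speed s

/-! ### Comparison with the parabola -/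

/-- A curve of positive curvature and of total curvature `π` is most curved among the complete
curves that are embedded as closed subsets: any excess of curvature near one point makes the total
curvature of the other curve larger than `π`. -/
theorem not_isClosedEmbedding_of_moreCurved {P C : ℝ → Plane} (hP : IsCompleteCurve P)
    (hpos : ∀ s, 0 < curvature P s)
    (hlim : Filter.Tendsto (fun R => ∫ s in (-R)..R, curvature P s) Filter.atTop (𝓝 Real.pi))
    (hC : IsCompleteCurve C) (hCP : MoreCurved C P) : ¬ IsClosedEmbedding C := by
  intro hemb
  obtain ⟨hle, s₀, hs₀⟩ := hCP
  have hPc := hP.continuous_curvature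
  have hCc := hC.continuous_curvature
  have hDc : Continuous fun s => curvature C s - curvature P s := hCc.sub hPc
  set δ := ∫ s in (s₀ - 1)..(s₀ + 1), (curvature C s - curvature P s) with hδ
  have hδ0 : 0 < δ :=
    intervalIntegral.integral_pos (by linarith) hDc.continuousOn
      (fun s _ => sub_nonneg.2 (hle s)) ⟨s₀, by constructor <;> linarith, sub_pos.2 hs₀⟩
  obtain ⟨R, hR1, hR2⟩ := ((hlim.eventually_const_lt (by linarith : Real.pi - δ < Real.pi)).and
    (Filter.eventually_ge_atTop (|s₀| + 1))).exists
  have habs := abs_le.1 (le_refl |s₀|)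
  have h1 : δ ≤ ∫ s in (-R)..R, (curvature C s - curvature P s) :=
    intervalIntegral.integral_mono_interval (by linarith) (by linarith) (by linarith)
      (Filter.Eventually.of_forall fun s => sub_nonneg.2 (hle s))
      (hDc.intervalIntegrable _ _)
  rw [intervalIntegral.integral_sub (hCc.intervalIntegrable _ _) (hPc.intervalIntegrable _ _)] at h1
  have h2 := hC.integral_curvature_le_pi hemb (fun s => (hpos s).trans_le (hle s))
    (by linarith [abs_nonneg s₀] : -R < R)
  linarith

theorem mainTheorem6 (S : Set Plane) (hS : IsParabola S) :
    (∃ P : ℝ → Plane, IsCompleteCurve P ∧ range P = S) ∧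
    ∀ P : ℝ → Plane, IsCompleteCurve P → range P = S →
      IsClosedEmbedding P ∧
      ∀ C : ℝ → Plane, IsCompleteCurve C → MoreCurved C P → ¬ IsClosedEmbedding C := by
  obtain ⟨k, hk, e, rfl⟩ := hS
  constructor
  · obtain ⟨x, hx⟩ := exists_isParabolaAbscissa k
    refine ⟨_, hx.isCompleteCurve.isometryEquiv_comp e, ?_⟩
    rw [range_comp' e]
    congr 1
    ext p
    constructor
    · rintro ⟨s, rfl⟩
      simp
    · intro hp
      obtain ⟨s, hs⟩ := hx.surjective (p 0)
      refine ⟨s, ?_⟩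
      ext i
      fin_cases i
      · simpa using hs
      · simpa [hs] using hp.symm
  · intro P hP hr
    have hγ := hP.isometryEquiv_comp e.symm
    have hrγ : range (fun s => e.symm (P s)) = {p : Plane | p 1 = k * p 0 ^ 2} := by
      rw [range_comp' e.symm, hr, ← image_comp]
      simp
    obtain ⟨x, hx, σ, hσ, h0, h1⟩ := exists_isParabolaAbscissa_of_range_eq hγ hrγ
    have hcurv : curvature P = fun s => 2 * k * deriv x s ^ 3 := by
      rw [← hP.curvature_isometryEquiv_comp e.symm]
      exact funext (hx.curvature_eq hk hγ hσ h0 h1)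
    refine ⟨?_, fun C hC hCP => not_isClosedEmbedding_of_moreCurved hP (fun s => ?_) ?_ hC hCP⟩
    · have hσ0 : σ ≠ 0 := by rintro rfl; simp at hσ
      have hPe : P = e ∘ (fun u : ℝ => (!₂[u, k * u ^ 2] : Plane)) ∘ (σ * ·) ∘ x := by
        funext s
        refine e.symm_apply_eq.1 ?_
        ext i
        fin_cases i
        · simpa using h0 s
        · simpa [mul_pow, hσ] using h1 s
      rw [hPe]
      exact e.toHomeomorph.isClosedEmbedding.comp ((isClosedEmbedding_graph_sq k).comp
        ((Homeomorph.mulLeft₀ σ hσ0).isClosedEmbedding.comp hx.isHomeomorph.isClosedEmbedding))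
    · rw [hcurv]
      have := hx.deriv_pos s
      positivity
    · rw [hcurv]
      exact hx.tendsto_integral hk
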